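/- For a Boolean algebra $A$ let $K_A$ be its Stone space, let $C(K_A)$ be the Banach space of real-valued continuous functions on $K_A$ with the supremum norm, and let $B_{C(K_A)^*}$ be the closed unit ball of its dual space, with the weak$^*$ topology. A chain in a Boolean algebra is called well-ordered if it is well-ordered by the order of the algebra. For every Boolean algebra $A$ there is a Boolean algebra $B$ such that 1. $B$ has the same cardinality as $A$; 2. every well-ordered chain in $B$ is countable; 3. there is a linear isometry of $C(K_A)$ onto a subspace of $C(K_B)$; 4. if $A$ is infinite, then $B$ is isomorphic to the algebra of clopen subsets of some totally disconnected compact Hausdorff space $L$ that admits a continuous surjection onto $B_{C(K_A)^*}$. -/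

import Mathlib

universe u

/-- The Stone space `K_A` of a Boolean algebra `A`: the homomorphisms from `A` to the two-element
Boolean algebra (equivalently, the ultrafilters of `A`). -/
def StoneSpace (A : Type u) [BooleanAlgebra A] : Type u :=
  BoundedLatticeHom A Bool

namespace StoneSpace

variable {A : Type u} [BooleanAlgebra A]

/-- The value of a point of the Stone space at `a`; it is `true` exactly if `a` belongs to the
corresponding ultrafilter. -/
noncomputable def eval (x : StoneSpace A) (a : A) : Bool :=
  (show BoundedLatticeHom A Bool from x) a

/-- The topology of pointwise convergence: the sets `{x | x a = true}` are a base of it. -/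
noncomputable instance : TopologicalSpace (StoneSpace A) :=
  TopologicalSpace.induced eval inferInstance

theorem isEmbedding_eval : Topology.IsEmbedding (eval : StoneSpace A → A → Bool) :=
  ⟨⟨rfl⟩, fun _ _ h => DFunLike.coe_injective (F := BoundedLatticeHom A Bool) h⟩

theorem isClosedEmbedding_eval :
    Topology.IsClosedEmbedding (eval : StoneSpace A → A → Bool) := by
  refine ⟨isEmbedding_eval, ?_⟩
  have h : Set.range (eval : StoneSpace A → A → Bool) =
      {f | (∀ a b, f (a ⊔ b) = (f a ⊔ f b)) ∧ (∀ a b, f (a ⊓ b) = (f a ⊓ f b)) ∧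
        f ⊤ = ⊤ ∧ f ⊥ = ⊥} := by
    ext f
    constructor
    · rintro ⟨x, rfl⟩
      exact ⟨fun a b => map_sup (show BoundedLatticeHom A Bool from x) a b,
        fun a b => map_inf (show BoundedLatticeHom A Bool from x) a b,
        map_top (show BoundedLatticeHom A Bool from x),
        map_bot (show BoundedLatticeHom A Bool from x)⟩
    · rintro ⟨h1, h2, h3, h4⟩
      exact ⟨(⟨⟨⟨f, h1⟩, h2⟩, h3, h4⟩ : BoundedLatticeHom A Bool), rfl⟩
  rw [h]
  simp only [Set.ofPred_and, Set.ofPred_forall]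
  have hp : ∀ a b : A, Continuous fun f : A → Bool => (f a, f b) := fun a b =>
    (continuous_apply a).prodMk (continuous_apply b)
  have hs : ∀ a b : A, Continuous fun f : A → Bool => f a ⊔ f b := fun a b =>
    Continuous.comp (g := fun p : Bool × Bool => p.1 ⊔ p.2) continuous_of_discreteTopology (hp a b)
  have hi : ∀ a b : A, Continuous fun f : A → Bool => f a ⊓ f b := fun a b =>
    Continuous.comp (g := fun p : Bool × Bool => p.1 ⊓ p.2) continuous_of_discreteTopology (hp a b)
  refine IsClosed.inter (isClosed_iInter fun a => isClosed_iInter fun b => ?_)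
    (IsClosed.inter (isClosed_iInter fun a => isClosed_iInter fun b => ?_)
      (IsClosed.inter ?_ ?_))
  · exact isClosed_eq (continuous_apply _) (hs a b)
  · exact isClosed_eq (continuous_apply _) (hi a b)
  · exact isClosed_eq (continuous_apply _) continuous_const
  · exact isClosed_eq (continuous_apply _) continuous_const

instance : CompactSpace (StoneSpace A) :=
  isClosedEmbedding_eval.compactSpace

instance : T2Space (StoneSpace A) :=
  isEmbedding_eval.t2Space

instance : TotallyDisconnectedSpace (StoneSpace A) :=
  isEmbedding_eval.isTotallyDisconnected_range.mp
    (isTotallyDisconnected_of_totallyDisconnectedSpace _)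

end StoneSpace

/-- Every chain of `B` which is well ordered by the order of `B` is countable. -/
def NoUncountableWellOrderedChains (B : Type u) [BooleanAlgebra B] : Prop :=
  ∀ S : Set B, IsChain (· ≤ ·) S → S.IsWF → S.Countable

/-- The closed unit ball of the dual of `X`, as a subset of the dual with the weak* topology. -/
def weakStarDualBall (X : Type u) [NormedAddCommGroup X] [NormedSpace ℝ X] :
    Set (WeakDual ℝ X) :=
  {φ | ‖WeakDual.toStrongDual φ‖ ≤ 1}

/-!
For an infinite Boolean algebra `A`, the dual ball of `C(K_A)` is a convex compact set `X`, and its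
points are separated by the affine functions `φ ↦ φ(1_a) - q` with `a` in `A` and `q` rational.
Splitting every zero of every one of these functions into a positive and a negative copy gives a
zero-dimensional compact space `L` (`SplitSpace`) that projects onto `X`, and `B` is the algebra of
its clopen subsets. A clopen set depends on finitely many signs (`SplitSpace.exists_support`), so
`B` has at most the cardinality of `A`; and since the signs at the zero functional can be chosen
freely, it has at least that cardinality. By Stone duality, `K_B` maps onto `L`, hence onto `X`,
which gives the isometric embedding of `C(K_A)`. For finite `A`, take `B = A`.

The point is that well-ordered chains in `B` are countable (`SplitSpace.countable_of_strictMono`).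
Suppose that an uncountable well-ordered chain of clopen sets `C α` is given. By the delta-system
lemma it may be assumed that their supports pairwise intersect in a fixed finite root. After
thinning out the chain once more, some sign pattern on the root is such that the cell of points
with this pattern contains a point `p` that belongs to all the `C α` and, by compactness, a point
`q` that belongs to none.
Move along the segment from the projection of `p` to that of `q`; because the functions are
affine, it stays in the projection of the cell. Let `G α` be the closed set of times at which some
point of the cell above belongs to `C α`, and `U α ⊆ G α` the open set of times at which all such
points do. Signs over a given point of `X` are independent, so for `α < β` a point of `C α` and a
point outside `C β` in the same fibre of the cell could be mixed into a point of `C α` outside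
`C β`; hence `G α ⊆ U β`. As `[0, 1]` is connected and the chain separates its end points, the
open sets `U α` are strictly increasing, so there are only countably many of them.
-/

open Set Topology

/-! ### Countability of chains and the delta-system lemma -/

/-- In a second countable space, a strictly increasing well-ordered family of open sets is
countable: each member is told apart from its successor by a basic open set, and no basic open set
serves twice. -/
theorem countable_of_strictMonoOn_opens {ι : Type*} [LinearOrder ι] [WellFoundedLT ι]
    {Y : Type*} [TopologicalSpace Y] [SecondCountableTopology Y] {S : Set ι} {U : ι → Set Y}
    (hU : ∀ α ∈ S, IsOpen (U α)) (hmono : ∀ α ∈ S, ∀ β ∈ S, α < β → U α ⊂ U β) :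
    S.Countable := by
  set S' : Set ι := {α ∈ S | ∃ β ∈ S, α < β} with hS'
  have hsucc : ∀ α ∈ S', ∃ σ ∈ S, α < σ ∧ ∀ β ∈ S, α < β → σ ≤ β := by
    rintro α ⟨-, β, hβ, hαβ⟩
    have hne : {β | β ∈ S ∧ α < β}.Nonempty := ⟨β, hβ, hαβ⟩
    exact ⟨wellFounded_lt.min _ hne, (wellFounded_lt.min_mem _ hne).1,
      (wellFounded_lt.min_mem _ hne).2,
      fun γ hγ hαγ => not_lt.1 (wellFounded_lt.not_lt_min (s := {β | β ∈ S ∧ α < β}) ⟨hγ, hαγ⟩)⟩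
  choose! σ hσS hlt hle using hsucc
  have hV : ∀ α ∈ S', ∃ V ∈ TopologicalSpace.countableBasis Y, V ⊆ U (σ α) ∧ ¬ V ⊆ U α := by
    intro α hα
    obtain ⟨t, ht, htn⟩ := exists_of_ssubset (hmono α hα.1 _ (hσS α hα) (hlt α hα))
    obtain ⟨V, hVb, htV, hVU⟩ :=
      (TopologicalSpace.isBasis_countableBasis Y).exists_subset_of_mem_open ht (hU _ (hσS α hα))
    exact ⟨V, hVb, hVU, fun h => htn (h htV)⟩
  choose! V hVb hVs hVn using hV
  have key : ∀ α ∈ S', ∀ β ∈ S', α < β → V α ≠ V β := by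
    intro α hα β hβ hαβ h
    have hsub : U (σ α) ⊆ U β := by
      rcases (hle α hα β hβ.1 hαβ).eq_or_lt with h | h
      · rw [h]
      · exact (hmono _ (hσS α hα) _ hβ.1 h).subset
    exact hVn β hβ (h ▸ (hVs α hα).trans hsub)
  have hc : S'.Countable := by
    refine MapsTo.countable_of_injOn (f := V) (fun α hα => hVb α hα) ?_
      (TopologicalSpace.countable_countableBasis Y)
    intro α hα β hβ h
    by_contra hne
    rcases lt_or_gt_of_ne hne with hlt | hlt
    · exact key α hα β hβ hlt h
    · exact key β hβ α hα hlt h.symm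
  have hs : (S \ S').Subsingleton := by
    intro α hα β hβ
    by_contra hne
    rcases lt_or_gt_of_ne hne with hlt | hlt
    · exact hα.2 ⟨hα.1, β, hβ.1, hlt⟩
    · exact hβ.2 ⟨hβ.1, α, hα.1, hlt⟩
  exact (hc.union hs.countable).mono fun α hα => by
    by_cases h : α ∈ S'
    · exact Or.inl h
    · exact Or.inr ⟨hα, h⟩

/-- The delta-system lemma for finite sets of a fixed size, by induction on the size: an element
that lies in uncountably many of the sets is moved to the root. -/
theorem exists_deltaSystem_of_card {ι I : Type*} [DecidableEq I] (n : ℕ) :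
    ∀ (S : Set ι) (F : ι → Finset I), ¬ S.Countable → (∀ s ∈ S, (F s).card = n) →
      ∃ T ⊆ S, ¬ T.Countable ∧ ∃ R : Finset I, T.Pairwise fun s t => F s ∩ F t = R := by
  induction n with
  | zero =>
    intro S F hS hF
    refine ⟨S, subset_rfl, hS, ∅, fun s hs t _ _ => ?_⟩
    simp [Finset.card_eq_zero.1 (hF s hs)]
  | succ n ih =>
    intro S F hS hF
    by_cases h : ∃ a, ¬ {s ∈ S | a ∈ F s}.Countable
    · obtain ⟨a, ha⟩ := h
      obtain ⟨T, hTS, hT, R, hR⟩ := ih {s ∈ S | a ∈ F s} (fun s => (F s).erase a) ha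
        (fun s hs => by rw [Finset.card_erase_of_mem hs.2, hF s hs.1]; rfl)
      refine ⟨T, fun s hs => (hTS hs).1, hT, insert a R, fun s hs t ht hst => ?_⟩
      rw [← hR hs ht hst]
      ext i
      have h1 := (hTS hs).2
      have h2 := (hTS ht).2
      by_cases hi : i = a
      · simp [hi, h1, h2]
      · simp [hi]
    · push Not at h
      -- A maximal disjoint subfamily works: otherwise its union would be a countable set that
      -- meets every member of the family.
      obtain ⟨M, -, hM⟩ := zorn_subset_nonempty
        {M | M ⊆ S ∧ M.Pairwise fun s t => F s ∩ F t = ∅} (by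
          intro c hc hchain _
          refine ⟨⋃₀ c, ⟨sUnion_subset fun M hM => (hc hM).1, ?_⟩,
            fun M hM => subset_sUnion_of_mem hM⟩
          exact (pairwise_sUnion hchain.directedOn).2 fun M hM => (hc hM).2)
        ∅ ⟨empty_subset _, pairwise_empty _⟩
      refine ⟨M, hM.prop.1, fun hMc => hS ?_, ∅, hM.prop.2⟩
      have hcov : S ⊆ ⋃ t ∈ M, ⋃ a ∈ F t, {s ∈ S | a ∈ F s} := by
        intro s hs
        by_contra hns
        simp only [mem_iUnion, not_exists, mem_ofPred_eq, not_and] at hns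
        have hins : insert s M ∈ {M | M ⊆ S ∧ M.Pairwise fun s t => F s ∩ F t = ∅} := by
          refine ⟨insert_subset hs hM.prop.1, pairwise_insert.2
            ⟨hM.prop.2, fun t ht _ => ?_⟩⟩
          have hst : F s ∩ F t = ∅ := Finset.eq_empty_of_forall_notMem fun a ha =>
            hns t ht a (Finset.mem_inter.1 ha).2 hs (Finset.mem_inter.1 ha).1
          exact ⟨hst, by rwa [Finset.inter_comm]⟩
        have hsM : s ∈ M := hM.le_of_ge hins (subset_insert _ _) (mem_insert _ _)
        obtain ⟨a, ha⟩ := Finset.card_pos.1 (by rw [hF s hs]; exact n.succ_pos)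
        exact hns s hsM a ha hs ha
      exact (hMc.biUnion fun t _ => (F t).countable_toSet.biUnion fun a _ => h a).mono hcov

theorem exists_deltaSystem {ι I : Type*} [DecidableEq I] {S : Set ι} (hS : ¬ S.Countable)
    (F : ι → Finset I) :
    ∃ T ⊆ S, ¬ T.Countable ∧ ∃ R : Finset I, T.Pairwise fun s t => F s ∩ F t = R := by
  have : ∃ n, ¬ {s ∈ S | (F s).card = n}.Countable := by
    by_contra! h
    exact hS ((countable_iUnion h).mono fun s hs =>
      (mem_iUnion (s := fun n => {s ∈ S | (F s).card = n})).2 ⟨_, hs, rfl⟩)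
  obtain ⟨n, hn⟩ := this
  obtain ⟨T, hT, h⟩ := exists_deltaSystem_of_card n _ F hn fun s hs => hs.2
  exact ⟨T, fun s hs => (hT hs).1, h⟩

/-! ### Splitting the zeros of a family of functions -/

/-- The space obtained from `X` by splitting every zero of every `f i` into a positive and a
negative copy: a point is a point `x` of `X` together with, for every `i`, a sign `b i` that agrees
with the weak sign of `f i x` (`true` for `0 ≤ f i x`, `false` for `f i x ≤ 0`). Signs at zeros
are chosen independently of each other. -/
def SplitSpace {X I : Type*} (f : I → X → ℝ) : Type _ :=
  {p : X × (I → Bool) // ∀ i, (p.2 i = true → 0 ≤ f i p.1) ∧ (p.2 i = false → f i p.1 ≤ 0)}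

namespace SplitSpace

variable {X I : Type*} {f : I → X → ℝ}

/-- The projection of the split space onto the original space. -/
def proj (p : SplitSpace f) : X := p.1.1

/-- The signs carried by a point of the split space. -/
def sign (p : SplitSpace f) : I → Bool := p.1.2

theorem nonneg_of_sign {p : SplitSpace f} {i : I} (h : p.sign i = true) : 0 ≤ f i p.proj :=
  (p.2 i).1 h

theorem nonpos_of_sign {p : SplitSpace f} {i : I} (h : p.sign i = false) : f i p.proj ≤ 0 :=
  (p.2 i).2 h

theorem exists_lift (x : X) (b : I → Bool) (F : Set I)
    (h : ∀ i ∈ F, (b i = true → 0 ≤ f i x) ∧ (b i = false → f i x ≤ 0)) :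
    ∃ p : SplitSpace f, p.proj = x ∧ ∀ i ∈ F, p.sign i = b i := by
  classical
  refine ⟨⟨(x, fun i => if i ∈ F then b i else decide (0 ≤ f i x)), fun i => ?_⟩, rfl,
    fun i hi => if_pos hi⟩
  by_cases hi : i ∈ F
  · simpa [hi] using h i hi
  · simpa [hi] using fun h => h.le

theorem proj_surjective : Function.Surjective (proj : SplitSpace f → X) := fun x =>
  let ⟨p, hp, _⟩ := exists_lift (f := f) x (fun _ => true) ∅ (by simp)
  ⟨p, hp⟩

/-- Signs of two points over the same `x` can be mixed at will. -/
theorem exists_mix {p q : SplitSpace f} (h : p.proj = q.proj) (F : Set I) :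
    ∃ z : SplitSpace f, (∀ i ∈ F, z.sign i = p.sign i) ∧ ∀ i ∉ F, z.sign i = q.sign i := by
  classical
  obtain ⟨z, -, hz⟩ := exists_lift (f := f) p.proj (fun i => if i ∈ F then p.sign i else q.sign i)
    univ (fun i _ => by
      by_cases hi : i ∈ F
      · simpa [hi] using ⟨nonneg_of_sign, nonpos_of_sign⟩
      · simpa [hi, h] using ⟨nonneg_of_sign, nonpos_of_sign⟩)
  exact ⟨z, fun i hi => by simp [hz, hi], fun i hi => by simp [hz, hi]⟩

/-- If the `f i` separate points strictly, the signs determine the point of `X` as well. -/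
theorem sign_injective (hsep : ∀ x y, x ≠ y → ∃ i, (f i x < 0 ∧ 0 < f i y) ∨
    (f i y < 0 ∧ 0 < f i x)) : Function.Injective (sign : SplitSpace f → I → Bool) := by
  intro p q h
  have hx : p.proj = q.proj := by
    by_contra hne
    have aux : ∀ (p q : SplitSpace f) (i : I), p.sign = q.sign →
        f i p.proj < 0 → 0 < f i q.proj → False := by
      intro p q i h h1 h2
      have hp : p.sign i = false := by
        by_contra hp
        exact h1.not_ge (nonneg_of_sign (by simpa using hp))
      exact h2.not_ge (nonpos_of_sign (by rw [← h, hp]))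
    obtain ⟨i, ⟨h1, h2⟩ | ⟨h1, h2⟩⟩ := hsep _ _ hne
    · exact aux p q i h h1 h2
    · exact aux q p i h.symm h1 h2
  exact Subtype.ext (Prod.ext hx h)

variable [TopologicalSpace X]

instance : TopologicalSpace (SplitSpace f) := inferInstanceAs (TopologicalSpace (Subtype _))

theorem continuous_proj : Continuous (proj : SplitSpace f → X) :=
  continuous_fst.comp continuous_subtype_val

theorem continuous_sign : Continuous (sign : SplitSpace f → I → Bool) :=
  continuous_snd.comp continuous_subtype_val

theorem isClopen_sign (i : I) (c : Bool) : IsClopen {p : SplitSpace f | p.sign i = c} :=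
  (isClopen_discrete {c}).preimage ((continuous_apply i).comp continuous_sign)

instance [T2Space X] : T2Space (SplitSpace f) := inferInstanceAs (T2Space (Subtype _))

theorem compactSpace [CompactSpace X] (hf : ∀ i, Continuous (f i)) :
    CompactSpace (SplitSpace f) := by
  refine isCompact_iff_compactSpace.1 (IsClosed.isCompact (s := {p : X × (I → Bool) |
    ∀ i, (p.2 i = true → 0 ≤ f i p.1) ∧ (p.2 i = false → f i p.1 ≤ 0)}) ?_)
  simp only [ofPred_forall, ofPred_and]
  have hc : ∀ (i : I) (c : Bool), IsOpen {p : X × (I → Bool) | p.2 i = c} := fun i c =>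
    (isOpen_discrete {c}).preimage
      (f := fun p : X × (I → Bool) => p.2 i) ((continuous_apply i).comp continuous_snd)
  refine isClosed_iInter fun i => IsClosed.inter ?_ ?_
  · exact isClosed_imp (hc i true) (isClosed_le continuous_const ((hf i).comp continuous_fst))
  · exact isClosed_imp (hc i false) (isClosed_le ((hf i).comp continuous_fst) continuous_const)

theorem totallyDisconnectedSpace
    (hs : Function.Injective (sign : SplitSpace f → I → Bool)) :
    TotallyDisconnectedSpace (SplitSpace f) :=
  ⟨fun _ _ ht _ hx _ hy => hs ((ht.image _ continuous_sign.continuousOn).subsingleton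
    (mem_image_of_mem _ hx) (mem_image_of_mem _ hy))⟩

/-- By compactness, a clopen set depends on only finitely many signs. -/
theorem exists_support [CompactSpace (SplitSpace f)]
    (hs : Function.Injective (sign : SplitSpace f → I → Bool)) {C : Set (SplitSpace f)}
    (hC : IsClopen C) :
    ∃ F : Finset I, ∀ p q : SplitSpace f, (∀ i ∈ F, p.sign i = q.sign i) → (p ∈ C ↔ q ∈ C) := by
  have hK : IsCompact (C ×ˢ Cᶜ) := hC.1.isCompact.prod hC.compl.1.isCompact
  obtain ⟨F, hF⟩ := hK.elim_finite_subcover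
    (fun i => {z : SplitSpace f × SplitSpace f | z.1.sign i ≠ z.2.sign i})
    (fun i => by
      have h1 : Continuous fun z : SplitSpace f × SplitSpace f => (z.1.sign i, z.2.sign i) :=
        (((continuous_apply i).comp continuous_sign).comp continuous_fst).prodMk
          (((continuous_apply i).comp continuous_sign).comp continuous_snd)
      exact (isOpen_discrete {z : Bool × Bool | z.1 ≠ z.2}).preimage h1)
    (by
      rintro ⟨p, q⟩ ⟨hp, hq⟩
      by_contra h
      simp only [mem_iUnion, mem_ofPred_eq, not_exists, not_not] at h
      exact hq (hs (funext h) ▸ hp))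
  have key : ∀ p q : SplitSpace f, (∀ i ∈ F, p.sign i = q.sign i) → p ∈ C → q ∈ C := by
    intro p q h hp
    by_contra hq
    obtain ⟨i, hi, hne⟩ := mem_iUnion₂.1 (hF (show (p, q) ∈ C ×ˢ Cᶜ from ⟨hp, hq⟩))
    exact hne (h i hi)
  exact ⟨F, fun p q h => ⟨key p q h, key q p fun i hi => (h i hi).symm⟩⟩

/-- A strictly increasing well-ordered family of clopen sets in the split space is countable, as
soon as any two points of `X` can be joined by a path along which no `f i` leaves a half-line
`[0, ∞)` or `(-∞, 0]` containing both of its end values. -/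
theorem countable_of_strictMono [CompactSpace (SplitSpace f)] [T2Space X]
    (hs : Function.Injective (sign : SplitSpace f → I → Bool))
    (hpath : ∀ x y : X, ∃ γ : Path x y, ∀ i t,
      (0 ≤ f i x → 0 ≤ f i y → 0 ≤ f i (γ t)) ∧ (f i x ≤ 0 → f i y ≤ 0 → f i (γ t) ≤ 0))
    {ι : Type*} [LinearOrder ι] [WellFoundedLT ι] {C : ι → Set (SplitSpace f)}
    (hC : ∀ α, IsClopen (C α)) (hmono : StrictMono C) : Countable ι := by
  classical
  by_contra hι
  choose F hF using fun α => exists_support hs (hC α)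
  obtain ⟨T, -, hT, R, hR⟩ := exists_deltaSystem (S := (univ : Set ι))
    (by rwa [countable_univ_iff]) F
  -- `cell r` is the set of points with sign pattern `r` on the root of the delta-system.
  let cell : (R → Bool) → Set (SplitSpace f) := fun r => {p | ∀ i : R, p.sign i = r i}
  let Tr : (R → Bool) → Set ι := fun r =>
    {α ∈ T | (C α ∩ cell r).Nonempty ∧ ((C α)ᶜ ∩ cell r).Nonempty}
  -- Only finitely many `C α` are unions of cells.
  have hr : ∃ r, ¬ (Tr r).Countable := by
    by_contra! h
    refine hT ((?_ : (T \ ⋃ r, Tr r).Countable).union (countable_iUnion h) |>.mono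
      (by rw [sdiff_union_self]; exact subset_union_left))
    refine MapsTo.countable_of_injOn (f := fun α => {r | (C α ∩ cell r).Nonempty})
      (t := univ) (fun _ _ => mem_univ _) ?_ (toFinite _).countable
    have key : ∀ α ∈ T \ ⋃ r, Tr r, ∀ p, p ∈ C α ↔ (C α ∩ cell fun i => p.sign i).Nonempty := by
      intro α hα p
      refine ⟨fun hp => ⟨p, hp, fun _ => rfl⟩, fun hp => ?_⟩
      by_contra hpn
      exact hα.2 (mem_iUnion.2 ⟨fun i => p.sign i, hα.1, hp, ⟨p, hpn, fun _ => rfl⟩⟩)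
    intro α hα β hβ hαβ
    refine hmono.injective (ext fun p => ?_)
    rw [key α hα, key β hβ]
    exact (Set.ext_iff.1 hαβ) _
  obtain ⟨r, hr⟩ := hr
  have hcell : IsClosed (cell r) := by
    simp only [cell, ofPred_forall]
    exact isClosed_iInter fun i => (isClopen_sign _ _).1
  have hne : (Tr r).Nonempty := by
    by_contra h
    rw [not_nonempty_iff_eq_empty.1 h] at hr
    exact hr countable_empty
  obtain ⟨p, hp⟩ : ∃ p ∈ cell r, ∀ α ∈ Tr r, p ∈ C α := by
    obtain ⟨p, hp, hpr⟩ := (wellFounded_lt.min_mem _ hne).2.1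
    exact ⟨p, hpr, fun α hα => hmono.monotone (not_lt.1 (wellFounded_lt.not_lt_min _ hα)) hp⟩
  obtain ⟨q, hq⟩ : ∃ q ∈ cell r, ∀ α ∈ Tr r, q ∉ C α := by
    have : Nonempty (Tr r) := hne.to_subtype
    have := IsCompact.nonempty_iInter_of_directed_nonempty_isCompact_isClosed
      (fun α : Tr r => (C α)ᶜ ∩ cell r)
      (Antitone.directed_ge fun α β h => by
        exact inter_subset_inter_left _ (compl_subset_compl.2 (hmono.monotone h)))
      (fun α => α.2.2.2) (fun α => ((hC α).compl.1.inter hcell).isCompact)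
      (fun α => (hC α).compl.1.inter hcell)
    obtain ⟨q, hq⟩ := this
    rw [mem_iInter] at hq
    exact ⟨q, (hq ⟨_, hne.some_mem⟩).2, fun α hα => (hq ⟨α, hα⟩).1⟩
  obtain ⟨γ, hγ⟩ := hpath p.proj q.proj
  -- The path stays in the projection of the cell.
  have hlift : ∀ t, ∃ z ∈ cell r, z.proj = γ t := by
    intro t
    obtain ⟨z, hz, hzr⟩ := exists_lift (f := f) (γ t) p.sign R (by
      intro i hi
      have hpq : q.sign i = p.sign i := (hq.1 ⟨i, hi⟩).trans (hp.1 ⟨i, hi⟩).symm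
      exact ⟨fun h => (hγ i t).1 (nonneg_of_sign h) (nonneg_of_sign (hpq.trans h)),
        fun h => (hγ i t).2 (nonpos_of_sign h) (nonpos_of_sign (hpq.trans h))⟩)
    exact ⟨z, fun i => (hzr i i.2).trans (hp.1 i), hz⟩
  let G : ι → Set unitInterval := fun α => γ ⁻¹' (proj '' (C α ∩ cell r))
  let U : ι → Set unitInterval := fun α => (γ ⁻¹' (proj '' ((C α)ᶜ ∩ cell r)))ᶜ
  have hG : ∀ α, IsClosed (G α) := fun α =>
    ((((hC α).1.inter hcell).isCompact.image continuous_proj).isClosed).preimage γ.continuous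
  have hU : ∀ α, IsOpen (U α) := fun α =>
    (((((hC α).compl.1.inter hcell).isCompact.image continuous_proj).isClosed).preimage
      γ.continuous).isOpen_compl
  have hUG : ∀ α, U α ⊆ G α := by
    intro α t ht
    obtain ⟨z, hz, hzt⟩ := hlift t
    by_cases hzα : z ∈ C α
    · exact ⟨z, ⟨hzα, hz⟩, hzt⟩
    · exact absurd ⟨z, ⟨hzα, hz⟩, hzt⟩ ht
  -- A point of `C α` and a point outside `C β` over the same point of `X` with the same signs on
  -- the root can be mixed to a point of `C α` outside `C β`.
  have hGU : ∀ α ∈ Tr r, ∀ β ∈ Tr r, α < β → G α ⊆ U β := by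
    rintro α hα β hβ hαβ t ⟨y, ⟨hyα, hyr⟩, hyt⟩ ⟨z, ⟨hzβ, hzr⟩, hzt⟩
    obtain ⟨w, hw1, hw2⟩ := exists_mix (hyt.trans hzt.symm) (F α : Set I)
    have hwα : w ∈ C α := (hF α w y hw1).2 hyα
    refine hzβ ((hF β w z fun i hi => ?_).1 (hmono.monotone hαβ.le hwα))
    by_cases hiα : i ∈ F α
    · have hiR : i ∈ R := by
        rw [← hR hα.1 hβ.1 hαβ.ne]
        exact Finset.mem_inter.2 ⟨hiα, hi⟩
      exact (hw1 i hiα).trans ((hyr ⟨i, hiR⟩).trans (hzr ⟨i, hiR⟩).symm)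
    · exact hw2 i hiα
  refine hr (countable_of_strictMonoOn_opens (fun α _ => hU α) fun α hα β hβ hαβ => ?_)
  refine ((hUG α).trans (hGU α hα β hβ hαβ)).ssubset_of_ne fun h => ?_
  -- Otherwise `U β = G α` is clopen in the unit interval, contains `0` and misses `1`.
  have hcl : IsClopen (U β) := by
    refine ⟨?_, hU β⟩
    rw [(hGU α hα β hβ hαβ).antisymm' (h ▸ hUG α)]
    exact hG α
  have h0 : (0 : unitInterval) ∈ U β :=
    hGU α hα β hβ hαβ ⟨p, ⟨hp.2 α hα, hp.1⟩, γ.source.symm⟩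
  have h1 : (1 : unitInterval) ∉ U β := fun h => h ⟨q, ⟨hq.2 β hβ, hq.1⟩, γ.target.symm⟩
  exact h1 (hcl.eq_univ ⟨0, h0⟩ ▸ mem_univ _)

end SplitSpace

namespace SplitSpace

open Cardinal TopologicalSpace

theorem mk_clopens_le {X I : Type u} [TopologicalSpace X] {f : I → X → ℝ} [Infinite I]
    [CompactSpace (SplitSpace f)] (hs : Function.Injective (sign : SplitSpace f → I → Bool)) :
    #(Clopens (SplitSpace f)) ≤ #I := by
  classical
  choose F hF using fun C : Clopens (SplitSpace f) => exists_support hs C.isClopen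
  -- A clopen set is determined by a support and by the sign patterns of its points there.
  let pat : Clopens (SplitSpace f) → SplitSpace f → Finset I :=
    fun C p => (F C).filter fun i => p.sign i = true
  let code : Clopens (SplitSpace f) → Finset I × Finset (Finset I) := fun C =>
    (F C, (F C).powerset.filter fun s => ∃ p ∈ C, pat C p = s)
  have hmem : ∀ C p, p ∈ C ↔ pat C p ∈ (code C).2 := by
    intro C p
    constructor
    · exact fun hp => Finset.mem_filter.2
        ⟨Finset.mem_powerset.2 (Finset.filter_subset _ _), p, hp, rfl⟩
    · intro h
      obtain ⟨p', hp', h'⟩ := (Finset.mem_filter.1 h).2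
      refine (hF C p' p fun i hi => ?_).1 hp'
      have := Finset.ext_iff.1 h' i
      simp only [pat, Finset.mem_filter, hi, true_and] at this
      exact Bool.eq_iff_iff.2 this
  have hinj : Function.Injective code := by
    intro C D h
    refine SetLike.ext fun p => ?_
    have hFCD : F C = F D := congrArg Prod.fst h
    rw [hmem, hmem, h]
    simp only [pat, hFCD]
  calc #(Clopens (SplitSpace f)) ≤ #(Finset I × Finset (Finset I)) := mk_le_of_injective hinj
    _ = #I := by
      rw [mk_prod, lift_id, lift_id, mk_finset_of_infinite, mk_finset_of_infinite,
        mk_finset_of_infinite, mul_eq_self (aleph0_le_mk I)]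

/-- A well-ordered chain of clopen sets of the split space is countable: the conclusion of
`countable_of_strictMono` for the algebra of clopen sets. -/
theorem noUncountableWellOrderedChains {X I : Type u} [TopologicalSpace X] {f : I → X → ℝ}
    [CompactSpace (SplitSpace f)] [T2Space X]
    (hs : Function.Injective (sign : SplitSpace f → I → Bool))
    (hpath : ∀ x y : X, ∃ γ : Path x y, ∀ i t,
      (0 ≤ f i x → 0 ≤ f i y → 0 ≤ f i (γ t)) ∧ (f i x ≤ 0 → f i y ≤ 0 → f i (γ t) ≤ 0)) :
    NoUncountableWellOrderedChains (Clopens (SplitSpace f)) := by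
  classical
  intro S hS hwf
  let _ : LinearOrder S := hS.linearOrder
  have : WellFoundedLT S := ⟨hwf⟩
  exact countable_of_strictMono (ι := S) hs hpath (C := fun α => (α.1 : Set (SplitSpace f)))
    (fun α => α.1.isClopen) fun α β h => SetLike.coe_ssubset_coe.2 h

end SplitSpace

/-! ### Stone spaces -/

/-- The surjectivity half of Stone duality: a zero-dimensional compact space is the image of the
Stone space of its clopen algebra. -/
theorem exists_continuous_surjective_stoneSpace_clopens (L : Type u) [TopologicalSpace L]
    [CompactSpace L] [T2Space L] [TotallyDisconnectedSpace L] :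
    ∃ s : StoneSpace (TopologicalSpace.Clopens L) → L, Continuous s ∧ Function.Surjective s := by
  classical
  let e : L → StoneSpace (TopologicalSpace.Clopens L) := fun p =>
    (⟨⟨⟨fun C => decide (p ∈ C), fun C D => by
        simp [← SetLike.mem_coe, Bool.decide_or]⟩,
      fun C D => by simp [← SetLike.mem_coe, Bool.decide_and]⟩,
      by simp [← SetLike.mem_coe], by simp [← SetLike.mem_coe]⟩ :
      BoundedLatticeHom (TopologicalSpace.Clopens L) Bool)
  have he : ∀ p C, (e p).eval C = decide (p ∈ C) := fun p C => rfl
  have hcont : Continuous e := by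
    rw [StoneSpace.isEmbedding_eval.continuous_iff]
    refine continuous_pi fun C => continuous_discrete_rng.2 fun b => ?_
    cases b
    · convert C.isClopen.compl.2 using 1
      ext p; simp [he]
    · convert C.isClopen.2 using 1
      ext p; simp [he]
  have hinj : Function.Injective e := by
    intro p q h
    by_contra hne
    obtain ⟨U, hU, hpU, hqU⟩ := exists_isClopen_of_totally_separated hne
    have := (he p ⟨U, hU⟩).symm.trans (h ▸ he q ⟨U, hU⟩)
    rw [decide_eq_decide] at this
    exact hqU (this.1 hpU)
  have hsurj : Function.Surjective e := by
    intro x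
    have hinf : ∀ C D, x.eval (C ⊓ D) = (x.eval C && x.eval D) := fun C D =>
      map_inf (show BoundedLatticeHom (TopologicalSpace.Clopens L) Bool from x) C D
    have htop : x.eval ⊤ = true :=
      map_top (show BoundedLatticeHom (TopologicalSpace.Clopens L) Bool from x)
    have hbot : x.eval ⊥ = false :=
      map_bot (show BoundedLatticeHom (TopologicalSpace.Clopens L) Bool from x)
    have hsup : ∀ C D, x.eval (C ⊔ D) = (x.eval C || x.eval D) := fun C D =>
      map_sup (show BoundedLatticeHom (TopologicalSpace.Clopens L) Bool from x) C D
    let T := {C : TopologicalSpace.Clopens L // x.eval C = true}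
    have : Nonempty T := ⟨⟨⊤, htop⟩⟩
    obtain ⟨p, hp⟩ := IsCompact.nonempty_iInter_of_directed_nonempty_isCompact_isClosed
      (fun C : T => (C.1 : Set L))
      (fun C D => ⟨⟨C.1 ⊓ D.1, by rw [hinf, C.2, D.2]; rfl⟩,
        (inf_le_left : C.1 ⊓ D.1 ≤ C.1), (inf_le_right : C.1 ⊓ D.1 ≤ D.1)⟩)
      (fun C => by
        by_contra h
        have : C.1 = ⊥ := SetLike.coe_injective (by simpa [not_nonempty_iff_eq_empty] using h)
        have h2 := C.2
        rw [this, hbot] at h2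
        exact Bool.false_ne_true h2)
      (fun C => C.1.isClopen.1.isCompact) (fun C => C.1.isClopen.1)
    rw [mem_iInter] at hp
    refine ⟨p, StoneSpace.isEmbedding_eval.injective (funext fun C => ?_)⟩
    rw [he]
    by_cases hC : x.eval C = true
    · rw [hC]
      simpa using hp ⟨C, hC⟩
    · have h1 : x.eval Cᶜ = true := by
        have := hsup C Cᶜ
        rw [sup_compl_eq_top, htop] at this
        simpa [hC] using this.symm
      have h2 : p ∉ C := hp ⟨Cᶜ, h1⟩
      simpa [h2] using hC
  let E := hcont.homeoOfEquivCompactToT2 (f := Equiv.ofBijective e ⟨hinj, hsurj⟩)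
  exact ⟨E.symm, E.symm.continuous, E.symm.surjective⟩

namespace StoneSpace

variable {A : Type u} [BooleanAlgebra A]

/-- The indicator function of the clopen set of the Stone space given by `a`. -/
noncomputable def indicator (a : A) : C(StoneSpace A, ℝ) where
  toFun x := if x.eval a then 1 else 0
  continuous_toFun := (continuous_of_discreteTopology
    (f := fun b : Bool => if b then (1 : ℝ) else 0)).comp
    ((continuous_apply a).comp isEmbedding_eval.continuous)

theorem indicator_apply (a : A) (x : StoneSpace A) :
    indicator a x = if x.eval a then 1 else 0 := rfl

theorem eval_inf (x : StoneSpace A) (a b : A) : x.eval (a ⊓ b) = (x.eval a && x.eval b) :=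
  map_inf (show BoundedLatticeHom A Bool from x) a b

theorem eval_top (x : StoneSpace A) : x.eval ⊤ = true :=
  map_top (show BoundedLatticeHom A Bool from x)

/-- By the Stone–Weierstrass theorem, the indicators span a dense subspace. -/
theorem dense_span_indicator :
    Dense (Submodule.span ℝ (range (indicator : A → C(StoneSpace A, ℝ))) :
      Set C(StoneSpace A, ℝ)) := by
  have hsub : (Submonoid.closure (range (indicator : A → C(StoneSpace A, ℝ))) : Set _) ⊆
      (Submodule.span ℝ (range (indicator : A → C(StoneSpace A, ℝ))) :
        Set C(StoneSpace A, ℝ)) := by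
    refine Subset.trans ?_ Submodule.subset_span
    let M : Submonoid C(StoneSpace A, ℝ) :=
      { carrier := range indicator
        one_mem' := ⟨⊤, by ext x; simp [indicator_apply, eval_top]⟩
        mul_mem' := by
          rintro _ _ ⟨a, rfl⟩ ⟨b, rfl⟩
          refine ⟨a ⊓ b, ?_⟩
          ext x
          cases ha : x.eval a <;> cases hb : x.eval b <;>
            simp [indicator_apply, eval_inf, ha, hb] }
    exact (Submonoid.closure_le (S := M)).2 subset_rfl
  have hadj := Algebra.adjoin_eq_span_of_subset ℝ hsub
  have hsw := ContinuousMap.subalgebra_topologicalClosure_eq_top_of_separatesPoints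
    (Algebra.adjoin ℝ (range (indicator : A → C(StoneSpace A, ℝ)))) (by
      intro x y hxy
      obtain ⟨a, ha⟩ : ∃ a, x.eval a ≠ y.eval a := by
        by_contra! h
        exact hxy (isEmbedding_eval.injective (funext h))
      refine ⟨indicator a, ⟨_, Algebra.subset_adjoin ⟨a, rfl⟩, rfl⟩, ?_⟩
      cases hx : x.eval a <;> cases hy : y.eval a <;> simp_all [indicator_apply])
  rw [← hadj]
  refine dense_iff_closure_eq.2 ?_
  have := congrArg (fun S : Subalgebra ℝ C(StoneSpace A, ℝ) => (S : Set C(StoneSpace A, ℝ))) hsw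
  simpa using this

end StoneSpace

/-! ### The dual ball -/

section DualBall

variable (X : Type u) [NormedAddCommGroup X] [NormedSpace ℝ X]

theorem convex_weakStarDualBall : Convex ℝ (weakStarDualBall X) := by
  have : weakStarDualBall X =
      (WeakDual.toStrongDual : WeakDual ℝ X ≃ₗ[ℝ] StrongDual ℝ X).toLinearMap ⁻¹'
        Metric.closedBall 0 1 := by
    ext φ; simp [weakStarDualBall]
  rw [this]
  exact (convex_closedBall _ _).linear_preimage _

theorem isCompact_weakStarDualBall : IsCompact (weakStarDualBall X) := by
  convert WeakDual.isCompact_closedBall (𝕜 := ℝ) (E := X) 0 1 using 1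
  ext φ; simp [weakStarDualBall]

variable {X}

/-- A Banach space embeds isometrically into the continuous functions on any compact space that
maps onto its dual ball. -/
theorem exists_linearIsometry_of_surjective {M : Type*} [TopologicalSpace M] [CompactSpace M]
    {q : M → weakStarDualBall X} (hq : Continuous q) (hsurj : Function.Surjective q) :
    Nonempty (X →ₗᵢ[ℝ] C(M, ℝ)) := by
  refine ⟨⟨
    { toFun := fun g => ⟨fun m => (q m).1 g,
        (WeakDual.eval_continuous g).comp (continuous_subtype_val.comp hq)⟩
      map_add' := fun g h => by ext m; simp
      map_smul' := fun c g => by ext m; simp }, fun g => ?_⟩⟩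
  refine le_antisymm ((ContinuousMap.norm_le _ (norm_nonneg g)).2 fun m => ?_) ?_
  · have h1 := (WeakDual.toStrongDual (q m).1).le_opNorm g
    exact h1.trans (mul_le_of_le_one_left (norm_nonneg g) (q m).2)
  · obtain ⟨φ, hφ, hφg⟩ := exists_dual_vector'' ℝ g
    obtain ⟨m, hm⟩ := hsurj ⟨StrongDual.toWeakDual φ, hφ⟩
    refine le_trans ?_ (ContinuousMap.norm_coe_le_norm _ m)
    have : (q m).1 g = ‖g‖ := by rw [hm]; exact hφg
    change ‖g‖ ≤ ‖(q m).1 g‖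
    rw [this, norm_norm]

/-- Signs of affine functions that agree at the ends of a segment persist along the segment. -/
theorem exists_path_weakStarDualBall (x y : weakStarDualBall X) :
    ∃ γ : Path x y, ∀ (g : X) (c : ℝ) t,
      (0 ≤ x.1 g - c → 0 ≤ y.1 g - c → 0 ≤ (γ t).1 g - c) ∧
      (x.1 g - c ≤ 0 → y.1 g - c ≤ 0 → (γ t).1 g - c ≤ 0) := by
  have hmem : ∀ t : unitInterval, (1 - (t : ℝ)) • x.1 + (t : ℝ) • y.1 ∈ weakStarDualBall X :=
    fun t => convex_weakStarDualBall X x.2 y.2 (sub_nonneg.2 t.2.2) t.2.1 (by ring)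
  refine ⟨⟨⟨fun t => ⟨_, hmem t⟩, ?_⟩, ?_, ?_⟩, fun g c t => ?_⟩
  · refine Continuous.subtype_mk ?_ _
    exact ((continuous_const.sub continuous_subtype_val).smul continuous_const).add
      (continuous_subtype_val.smul continuous_const)
  · simp
  · simp
  · have h : ((1 - (t : ℝ)) • x.1 + (t : ℝ) • y.1) g - c =
        (1 - (t : ℝ)) * (x.1 g - c) + (t : ℝ) * (y.1 g - c) := by
      change (1 - (t : ℝ)) * x.1 g + (t : ℝ) * y.1 g - c = _
      ring
    change (0 ≤ _ → 0 ≤ _ → 0 ≤ ((1 - (t : ℝ)) • x.1 + (t : ℝ) • y.1) g - c) ∧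
      (_ → _ → ((1 - (t : ℝ)) • x.1 + (t : ℝ) • y.1) g - c ≤ 0)
    rw [h]
    have h0 : 0 ≤ (t : ℝ) := t.2.1
    have h1 : 0 ≤ 1 - (t : ℝ) := sub_nonneg.2 t.2.2
    exact ⟨fun hx hy => add_nonneg (mul_nonneg h1 hx) (mul_nonneg h0 hy),
      fun hx hy => add_nonpos (mul_nonpos_of_nonneg_of_nonpos h1 hx)
        (mul_nonpos_of_nonneg_of_nonpos h0 hy)⟩

end DualBall

/-- The affine functions `φ ↦ φ(1_a) - q` on the dual ball of `C(K_A)`, for `a` in `A` and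
rational `q`, whose zeros are split. -/
noncomputable def dualBallFun (A : Type u) [BooleanAlgebra A] (i : A × ℚ)
    (φ : weakStarDualBall C(StoneSpace A, ℝ)) : ℝ :=
  φ.1 (StoneSpace.indicator i.1) - i.2

section DualBallFun

variable {A : Type u} [BooleanAlgebra A]

theorem continuous_dualBallFun (i : A × ℚ) : Continuous (dualBallFun A i) :=
  ((WeakDual.eval_continuous _).comp continuous_subtype_val).sub continuous_const

theorem dualBallFun_separates (φ ψ : weakStarDualBall C(StoneSpace A, ℝ)) (h : φ ≠ ψ) :
    ∃ i, (dualBallFun A i φ < 0 ∧ 0 < dualBallFun A i ψ) ∨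
      (dualBallFun A i ψ < 0 ∧ 0 < dualBallFun A i φ) := by
  obtain ⟨a, ha⟩ : ∃ a : A, φ.1 (StoneSpace.indicator a) ≠ ψ.1 (StoneSpace.indicator a) := by
    by_contra! hall
    refine h (Subtype.ext (WeakDual.toStrongDual.injective
      (ContinuousLinearMap.ext_on StoneSpace.dense_span_indicator ?_)))
    rintro _ ⟨a, rfl⟩
    exact hall a
  rcases lt_or_gt_of_ne ha with hlt | hlt
  all_goals
    obtain ⟨q, h1, h2⟩ := exists_rat_btwn hlt
    refine ⟨(a, q), ?_⟩
    simp only [dualBallFun, sub_neg, sub_pos]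
    tauto

/-- At the zero functional the signs at `(a, 0)` are free, so they give distinct clopen sets. -/
theorem injective_clopens_sign_zero : Function.Injective fun a : A =>
    (⟨{p | p.sign (a, 0) = true}, SplitSpace.isClopen_sign _ _⟩ :
      TopologicalSpace.Clopens (SplitSpace (dualBallFun A))) := by
  classical
  intro a b hab
  by_contra hne
  have h0 : (0 : WeakDual ℝ C(StoneSpace A, ℝ)) ∈ weakStarDualBall C(StoneSpace A, ℝ) := by
    simp [weakStarDualBall]
  obtain ⟨p, -, hp⟩ := SplitSpace.exists_lift (f := dualBallFun A) ⟨0, h0⟩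
    (fun i => decide (i.1 = a)) {(a, 0), (b, 0)} (by
      have hz : ∀ c : A, dualBallFun A (c, 0) ⟨0, h0⟩ = 0 := fun c =>
        show (0 : ℝ) - ((0 : ℚ) : ℝ) = 0 by simp
      rintro i (rfl | rfl) <;> simp [hz])
  have ha : p.sign (a, 0) = true := by simpa using hp (a, 0) (by simp)
  have hb : p.sign (b, 0) = false := by simpa [Ne.symm hne] using hp (b, 0) (by simp)
  have hmem : p ∈ {p : SplitSpace (dualBallFun A) | p.sign (a, 0) = true} := ha
  have heq : {p : SplitSpace (dualBallFun A) | p.sign (a, 0) = true} =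
      {p | p.sign (b, 0) = true} := congrArg TopologicalSpace.Clopens.carrier hab
  rw [heq] at hmem
  exact Bool.false_ne_true (hb.symm.trans hmem)

end DualBallFun

theorem mainTheorem2 (A : Type u) [BooleanAlgebra A] :
    ∃ (B : Type u) (_ : BooleanAlgebra B),
      Cardinal.mk B = Cardinal.mk A ∧
      NoUncountableWellOrderedChains B ∧
      Nonempty (C(StoneSpace A, ℝ) →ₗᵢ[ℝ] C(StoneSpace B, ℝ)) ∧
      (Infinite A →
        ∃ (L : Type u) (_ : TopologicalSpace L) (_ : CompactSpace L) (_ : T2Space L)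
          (_ : TotallyDisconnectedSpace L),
          Nonempty (B ≃o TopologicalSpace.Clopens L) ∧
          ∃ q : L → weakStarDualBall C(StoneSpace A, ℝ),
            Continuous q ∧ Function.Surjective q) := by
  rcases finite_or_infinite A with hA | hA
  · exact ⟨A, inferInstance, rfl, fun S _ _ => S.toFinite.countable, ⟨LinearIsometry.id⟩,
      fun h => (h.not_finite hA).elim⟩
  have : CompactSpace (weakStarDualBall C(StoneSpace A, ℝ)) :=
    isCompact_iff_compactSpace.1 (isCompact_weakStarDualBall _)
  have hinj := SplitSpace.sign_injective (dualBallFun_separates (A := A))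
  have := SplitSpace.compactSpace (continuous_dualBallFun (A := A))
  have := SplitSpace.totallyDisconnectedSpace hinj
  have hq := SplitSpace.continuous_proj (f := dualBallFun A)
  have hqs := SplitSpace.proj_surjective (f := dualBallFun A)
  obtain ⟨s, hs, hss⟩ :=
    exists_continuous_surjective_stoneSpace_clopens (SplitSpace (dualBallFun A))
  refine ⟨TopologicalSpace.Clopens (SplitSpace (dualBallFun A)), inferInstance,
    le_antisymm ?_ (Cardinal.mk_le_of_injective injective_clopens_sign_zero),
    SplitSpace.noUncountableWellOrderedChains hinj fun x y => ?_,
    exists_linearIsometry_of_surjective (hq.comp hs) (hqs.comp hss),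
    fun _ => ⟨SplitSpace (dualBallFun A), inferInstance, inferInstance, inferInstance,
      inferInstance, ⟨OrderIso.refl _⟩, SplitSpace.proj, hq, hqs⟩⟩
  · refine (SplitSpace.mk_clopens_le hinj).trans ?_
    rw [Cardinal.mk_prod, Cardinal.mk_eq_aleph0 ℚ, Cardinal.lift_aleph0, Cardinal.lift_uzero,
      Cardinal.mul_aleph0_eq (Cardinal.aleph0_le_mk A)]
  · obtain ⟨γ, hγ⟩ := exists_path_weakStarDualBall x y
    exact ⟨γ, fun i t => hγ (StoneSpace.indicator i.1) i.2 t⟩
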